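/- Let $X$ be a complex Banach space and let $J=\mathbb R$ or $J=\mathbb R_+=[0,\infty)$. For $F\in L^1_{loc}(J,X)$ let $\overline F:\mathbb R\to X$ be the extension of $F$ by $0$, let $\mathcal D(\mathbb R)$ be the space of complex-valued smooth functions with compact support on $\mathbb R$, and for $\varphi\in\mathcal D(\mathbb R)$ put $\widehat\varphi(\omega)=\int_{\mathbb R}e^{-i\omega t}\varphi(t)\,dt$ and $(\overline F*\varphi)(t)=\int_{\mathbb R}\overline F(t-s)\varphi(s)\,ds$. Let $C_0(J,X)$ be the space of continuous functions $J\to X$ vanishing at infinity. The reduced Beurling spectrum of $F$ relative to $(C_0(J,X),\mathcal D)$ is $$sp_{C_0(J,X),\mathcal D}(F)=\{\omega\in\mathbb R:\ \widehat\varphi(\omega)=0\ \text{for every}\ \varphi\in\mathcal D(\mathbb R)\ \text{with}\ (\overline F*\varphi)|_J\in C_0(J,X)\}.$$ (1) Let $F\in L^1_{loc}(J,X)$ with $sp_{C_0(J,X),\mathcal D}(F)=\emptyset$. If $\psi\in\mathcal D(\mathbb R)$ is such that $(\overline F*\psi)|_J$ is uniformly continuous, then $\overline F*\psi\in C_0(\mathbb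 R,X)$. (2) This applies to every $F\in L^p(J,X)$ with $1\le p<\infty$: then $F\in L^1_{loc}(J,X)$, $sp_{C_0(J,X),\mathcal D}(F)=\emptyset$, and $(\overline F*\psi)|_J$ is uniformly continuous for every $\psi\in\mathcal D(\mathbb R)$. (3) If $X\neq\{0\}$ and $2<p<\infty$, there is $F\in L^p(J,X)$ such that the Fourier transform of $\overline F$, that is the distribution $\varphi\mapsto\int_{\mathbb R}\widehat\varphi(s)\overline F(s)\,ds$, is not regular: there is no $H\in L^1_{loc}(\mathbb R,X)$ with $\int_{\mathbb R}\widehat\varphi\,\overline F=\int_{\mathbb R}\varphi H$ for all $\varphi\in\mathcal D(\mathbb R)$. -/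

import Mathlib

open MeasureTheory
open scoped ENNReal Convolution Distributions ZeroAtInfty

noncomputable section

namespace ReducedSpectrum

/-- The space `𝓓(ℝ)` of complex-valued smooth functions on `ℝ` with compact support. -/
abbrev TestFn : Type := 𝓓((⊤ : TopologicalSpace.Opens ℝ), ℂ)

/-- The Fourier transform `φ̂(ω) = ∫ e^{-iωt} φ(t) dt`. -/
def hat (φ : ℝ → ℂ) (ω : ℝ) : ℂ :=
  ∫ t : ℝ, Complex.exp (-(Complex.I * ω * t)) * φ t

variable {X : Type*} [NormedAddCommGroup X] [NormedSpace ℂ X]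

/-- `F̄ * φ`, that is `t ↦ ∫ φ(s) F̄(t - s) ds`, where `F̄` is the extension by zero to `ℝ` of a
function `F` on `J`. A function on `J` is represented by a function on `ℝ` whose values
outside `J` are ignored. -/
def extConv (J : Set ℝ) (F : ℝ → X) (φ : ℝ → ℂ) : ℝ → X :=
  φ ⋆[ContinuousLinearMap.lsmul ℂ ℂ, volume] J.indicator F

/-- The reduced Beurling spectrum `sp_{𝒜,V}(F)` of a function `F` on `J`, relative to a set `𝒜` of
functions on `J` and a set `V` of functions on `ℝ`. -/
def reducedSpectrum (J : Set ℝ) (𝒜 : Set (J → X)) (V : Set (ℝ → ℂ)) (F : ℝ → X) : Set ℝ :=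
  {ω | ∀ φ ∈ V, J.domRestrict (extConv J F φ) ∈ 𝒜 → hat φ ω = 0}

/-- The space `C₀(J, X)` as a set of functions on `J`. -/
def C0 (J : Set ℝ) (X : Type*) [NormedAddCommGroup X] : Set (J → X) :=
  Set.range (fun g : C₀(J, X) => (g : J → X))

/-- The space `𝓓(ℝ)` as a set of functions on `ℝ`. -/
def testFns : Set (ℝ → ℂ) :=
  Set.range (fun φ : TestFn => (φ : ℝ → ℂ))

/-- The Fourier transform `φ ↦ ∫ φ̂(s) G(s) ds` of `G` is a regular distribution: it is given on
test functions by integration against a locally integrable function. (For `G ∈ Lᵖ` the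
integrals exist because `φ̂` is rapidly decreasing.) -/
def FourierIsRegular (G : ℝ → X) : Prop :=
  ∃ H : ℝ → X, LocallyIntegrable H volume ∧
    ∀ φ : TestFn, ∫ s : ℝ, hat φ s • G s = ∫ s : ℝ, φ s • H s

end ReducedSpectrum

end

namespace ReducedSpectrum

open Filter Topology ContinuousLinearMap
open scoped FourierTransform SchwartzMap ContDiff ComplexOrder

variable {X : Type*} [NormedAddCommGroup X] [NormedSpace ℂ X]

/-! (1) is a Wiener-type division argument for `G = F̄ * ψ`. Uniform continuity lets `G` be
approximated uniformly by `𝓕⁻χ * G` with `χ` smooth of compact support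
(`exists_bandLimited_convolution_close`). Empty spectrum and compactness give one test function `φ`
with `φ * F̄ → 0` and `𝓕 φ ≠ 0` on the support of `χ` (`exists_fourier_pos_on_compact`). Dividing,
`𝓕⁻χ = k * φ` with `k` Schwartz, so `𝓕⁻χ * G = k * (ψ * (φ * F̄))` vanishes at infinity, and hence
so does `G`.

(2) follows from Hölder's inequality and density of compactly supported continuous functions in
`Lᵖ`.

(3) is by contradiction. If all the transforms were regular, chirps `b(t) e^{int²}`, bounded with a
common compact support, would have transforms `Sₙ` acting pointwise boundedly on `Lᵖ(J)`. Uniform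
boundedness, tested on `conj Sₙ`, gives `‖Sₙ‖₂² ≤ C ‖Sₙ‖ₚ` on `J`. The left side stays bounded below
by Plancherel, while `sup |Sₙ| → 0` and `p > 2` force the right side to `0`. -/

/-! ### Convolutions: decay at infinity and associativity. -/

/-- Convolution with an integrable function preserves vanishing at infinity. -/
theorem tendsto_convolution_cocompact {h : ℝ → ℂ} (hh : Integrable h) {g : ℝ → X}
    (hg : Continuous g) (hg0 : Tendsto g (cocompact ℝ) (𝓝 0)) :
    Tendsto (h ⋆[lsmul ℂ ℂ] g) (cocompact ℝ) (𝓝 0) := by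
  obtain ⟨C, hC⟩ : ∃ C, ∀ x, ‖g x‖ ≤ C := by
    let g₀ : C₀(ℝ, X) := ⟨⟨g, hg⟩, hg0⟩
    exact ⟨‖g₀.toBCF‖, fun x => g₀.toBCF.norm_coe_le_norm x⟩
  have : (cocompact ℝ).IsCountablyGenerated := by
    rw [cocompact_eq_atBot_atTop]
    infer_instance
  have key : Tendsto (fun x => ∫ t, h t • g (x - t)) (cocompact ℝ) (𝓝 (∫ _ : ℝ, (0 : X))) := by
    refine tendsto_integral_filter_of_dominated_convergence (fun t => ‖h t‖ * C) ?_ ?_ ?_ ?_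
    · exact Eventually.of_forall fun x =>
        hh.aestronglyMeasurable.smul (hg.comp (by fun_prop)).aestronglyMeasurable
    · refine Eventually.of_forall fun x => Eventually.of_forall fun t => ?_
      rw [norm_smul]
      exact mul_le_mul_of_nonneg_left (hC _) (norm_nonneg _)
    · exact hh.norm.mul_const C
    · refine Eventually.of_forall fun t => ?_
      have := hg0.comp (Homeomorph.subRight t).isClosedEmbedding.tendsto_cocompact
      simpa using this.const_smul (h t)
  rw [integral_zero] at key
  exact key

theorem locallyIntegrable_norm {E : Type*} [NormedAddCommGroup E] {k : ℝ → E}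
    (hk : LocallyIntegrable k) : LocallyIntegrable fun t => ‖k t‖ := fun x =>
  let ⟨s, hs, hi⟩ := hk x
  ⟨s, hs, hi.norm⟩

section Assoc

variable [CompleteSpace X]

/-- Associativity of convolution when the middle factor is a continuous function with compact
support. -/
theorem convolution_assoc_of_hasCompactSupport {f φ : ℝ → ℂ} {k : ℝ → X} (hf : Integrable f)
    (hφ : Continuous φ) (hφc : HasCompactSupport φ) (hk : LocallyIntegrable k) {x : ℝ}
    (hx : Integrable fun t => ‖f t‖ * ((fun s => ‖φ s‖) ⋆[mul ℝ ℝ] fun s => ‖k s‖) (x - t)) :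
    ((f ⋆[lsmul ℂ ℂ] φ) ⋆[lsmul ℂ ℂ] k) x = (f ⋆[lsmul ℂ ℂ] (φ ⋆[lsmul ℂ ℂ] k)) x := by
  refine convolution_assoc (lsmul ℂ ℂ) (lsmul ℂ ℂ) (lsmul ℂ ℂ) (lsmul ℂ ℂ) ?_
    hf.aestronglyMeasurable hφ.aestronglyMeasurable hk.aestronglyMeasurable ?_ ?_ hx
  · intro a b z
    simp only [lsmul_apply, smul_eq_mul, mul_smul]
  · exact Eventually.of_forall
      (hφc.convolutionExists_right (lsmul ℂ ℂ) hf.locallyIntegrable hφ)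
  · exact Eventually.of_forall
      (hφc.norm.convolutionExists_left (mul ℝ ℝ) hφ.norm (locallyIntegrable_norm hk))

theorem convolution_assoc_compact {η φ : ℝ → ℂ} {k : ℝ → X} (hη : Continuous η)
    (hηc : HasCompactSupport η) (hφ : Continuous φ) (hφc : HasCompactSupport φ)
    (hk : LocallyIntegrable k) :
    (η ⋆[lsmul ℂ ℂ] φ) ⋆[lsmul ℂ ℂ] k = η ⋆[lsmul ℂ ℂ] (φ ⋆[lsmul ℂ ℂ] k) := by
  funext x
  refine convolution_assoc_of_hasCompactSupport (hη.integrable_of_hasCompactSupport hηc) hφ hφc hk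
    ?_
  refine hηc.norm.convolutionExists_left (mul ℝ ℝ) hη.norm (Continuous.locallyIntegrable ?_) x
  exact hφc.norm.continuous_convolution_left (mul ℝ ℝ) hφ.norm (locallyIntegrable_norm hk)

theorem convolution_left_comm {η φ : ℝ → ℂ} {k : ℝ → X} (hη : Continuous η)
    (hηc : HasCompactSupport η) (hφ : Continuous φ) (hφc : HasCompactSupport φ)
    (hk : LocallyIntegrable k) :
    η ⋆[lsmul ℂ ℂ] (φ ⋆[lsmul ℂ ℂ] k) = φ ⋆[lsmul ℂ ℂ] (η ⋆[lsmul ℂ ℂ] k) := by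
  have hcomm : η ⋆[lsmul ℂ ℂ] φ = φ ⋆[lsmul ℂ ℂ] η := by
    rw [← convolution_flip]
    congr 1
    ext
    simp
  rw [← convolution_assoc_compact hη hηc hφ hφc hk, ← convolution_assoc_compact hφ hφc hη hηc hk,
    hcomm]

/-- Associativity of convolution of a Schwartz function, a continuous function with compact support
and a continuous function of at most linear growth. -/
theorem convolution_assoc_schwartz (h : 𝓢(ℝ, ℂ)) {φ : ℝ → ℂ} {k : ℝ → X}
    (hφ : Continuous φ) (hφc : HasCompactSupport φ) (hk : Continuous k) {A B : ℝ}
    (hkb : ∀ t, ‖k t‖ ≤ A + B * |t|) :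
    (h ⋆[lsmul ℂ ℂ] φ) ⋆[lsmul ℂ ℂ] k = h ⋆[lsmul ℂ ℂ] (φ ⋆[lsmul ℂ ℂ] k) := by
  have hcont : Continuous ((fun s => ‖φ s‖) ⋆[mul ℝ ℝ] fun s => ‖k s‖) :=
    hφc.norm.continuous_convolution_left (mul ℝ ℝ) hφ.norm hk.norm.locallyIntegrable
  have hex := hφc.norm.convolutionExists_left (mul ℝ ℝ) hφ.norm
    (hk.norm.locallyIntegrable (μ := volume))
  have hφi : Integrable φ := hφ.integrable_of_hasCompactSupport hφc
  have hφi' : Integrable fun s => ‖φ s‖ * (|A| + |B| * |s|) :=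
    Continuous.integrable_of_hasCompactSupport (by fun_prop) hφc.norm.mul_right
  -- `|φ| * |k|` again grows at most linearly, which the decay of `h` absorbs.
  have hbound : ∀ t, ‖((fun s => ‖φ s‖) ⋆[mul ℝ ℝ] fun s => ‖k s‖) t‖ ≤
      (∫ s, ‖φ s‖ * (|A| + |B| * |s|)) + (|B| * ∫ s, ‖φ s‖) * |t| := by
    intro t
    simp only [convolution_def, mul_apply']
    rw [Real.norm_of_nonneg
      (integral_nonneg fun s => mul_nonneg (norm_nonneg (φ s)) (norm_nonneg (k (t - s)))),
      mul_right_comm, ← integral_const_mul, ← integral_add hφi' (hφi.norm.const_mul _)]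
    refine integral_mono (hex t) (hφi'.add (hφi.norm.const_mul _)) fun s => ?_
    have h1 : ‖k (t - s)‖ ≤ |A| + |B| * (|t| + |s|) := by
      refine (hkb _).trans (add_le_add (le_abs_self _) ?_)
      exact mul_le_mul (le_abs_self _) (abs_sub _ _) (abs_nonneg _) (abs_nonneg _)
    nlinarith [mul_le_mul_of_nonneg_left h1 (norm_nonneg (φ s))]
  funext x
  refine convolution_assoc_of_hasCompactSupport h.integrable hφ hφc hk.locallyIntegrable ?_
  set a := ∫ s, ‖φ s‖ * (|A| + |B| * |s|)
  set b := |B| * ∫ s, ‖φ s‖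
  have hb : 0 ≤ b := mul_nonneg (abs_nonneg _) (integral_nonneg fun _ => norm_nonneg _)
  have hdom : Integrable fun t => (a + b * |x|) * ‖h t‖ + b * (‖t‖ ^ 1 * ‖h t‖) :=
    (h.integrable.norm.const_mul _).add ((h.integrable_pow_mul volume 1).const_mul _)
  refine hdom.mono' (by fun_prop) (Eventually.of_forall fun t => ?_)
  rw [norm_mul, norm_norm]
  have h2 := hbound (x - t)
  have h3 : b * |x - t| ≤ b * (|x| + |t|) := mul_le_mul_of_nonneg_left (abs_sub _ _) hb
  simp only [pow_one, Real.norm_eq_abs t]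
  nlinarith [mul_le_mul_of_nonneg_left (h2.trans (add_le_add_right h3 a)) (norm_nonneg (h t))]

end Assoc

/-! ### Increments of uniformly continuous functions. -/

/-- Uniformly continuous functions on `ℝ` have increments of at most linear growth, with arbitrarily
small constant term. -/
theorem exists_increment_bound {E : Type*} [NormedAddCommGroup E] {G : ℝ → E}
    (hG : UniformContinuous G) {ε : ℝ} (hε : 0 < ε) :
    ∃ C, 0 ≤ C ∧ ∀ t s, ‖G (t - s) - G t‖ ≤ ε + C * |s| := by
  obtain ⟨δ, hδ, hd⟩ := Metric.uniformContinuous_iff.1 hG ε hε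
  have step : ∀ n : ℕ, ∀ t u, |u| < δ → ‖G (t - n * u) - G t‖ ≤ n * ε := by
    intro n t u hu
    induction n with
    | zero => simp
    | succ n ih =>
      have h1 : ‖G (t - (n + 1 : ℕ) * u) - G (t - n * u)‖ ≤ ε := by
        rw [← dist_eq_norm]
        refine (hd ?_).le
        rw [Real.dist_eq]
        convert hu using 1
        rw [← abs_neg]
        congr 1
        push_cast
        ring
      calc _ = ‖(G (t - (n + 1 : ℕ) * u) - G (t - n * u)) + (G (t - n * u) - G t)‖ := by simp
        _ ≤ ε + n * ε := (norm_add_le _ _).trans (add_le_add h1 ih)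
        _ = _ := by push_cast; ring
  refine ⟨ε / δ, by positivity, fun t s => ?_⟩
  -- The `+ 1` makes each step strictly shorter than `δ`; it costs only the constant term `ε`.
  set n := ⌊|s| / δ⌋₊ + 1
  have hn : |s| / δ < n := by simpa [n] using Nat.lt_floor_add_one (|s| / δ)
  have hn0 : (0 : ℝ) < n := lt_of_le_of_lt (by positivity) hn
  have hu : |s / n| < δ := by
    rw [abs_div, abs_of_pos hn0, div_lt_iff₀ hn0, mul_comm]
    exact (div_lt_iff₀ hδ).1 hn
  have := step n t (s / n) hu
  rw [mul_div_cancel₀ _ hn0.ne'] at this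
  refine this.trans ?_
  have h2 : (n : ℝ) ≤ |s| / δ + 1 := by
    simpa [n] using Nat.floor_le (by positivity : 0 ≤ |s| / δ)
  calc n * ε ≤ (|s| / δ + 1) * ε := mul_le_mul_of_nonneg_right h2 hε.le
    _ = _ := by ring

/-! ### Fourier transforms of test functions and division. -/

theorem hat_eq_fourier (φ : ℝ → ℂ) (w : ℝ) : hat φ w = 𝓕 φ (w / (2 * Real.pi)) := by
  rw [Real.fourier_eq', hat]
  refine integral_congr_ae (Eventually.of_forall fun t => ?_)
  have : (Real.pi : ℂ) ≠ 0 := mod_cast Real.pi_ne_zero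
  simp only [smul_eq_mul, RCLike.inner_apply, conj_trivial]
  congr 2
  push_cast
  field_simp

/-- The test function attached to a smooth function with compact support. -/
def mkTestFn (f : ℝ → ℂ) (hf : ContDiff ℝ ∞ f) (hc : HasCompactSupport f) : TestFn where
  toFun := f
  contDiff' := hf
  hasCompactSupport' := hc
  tsupport_subset' := Set.subset_univ _

theorem mem_testFns_iff {f : ℝ → ℂ} :
    f ∈ testFns ↔ ContDiff ℝ ∞ f ∧ HasCompactSupport f := by
  constructor
  · rintro ⟨φ, rfl⟩
    exact ⟨φ.contDiff, φ.hasCompactSupport⟩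
  · rintro ⟨hf, hc⟩
    exact ⟨mkTestFn f hf hc, rfl⟩

theorem exists_even_bump : ∃ b : ℝ → ℝ, ContDiff ℝ ∞ b ∧ HasCompactSupport b ∧ b 0 = 1 ∧
    (∀ x, b (-x) = b x) ∧ (∀ x, 0 ≤ b x) ∧ ∀ x, b x ≤ 1 := by
  let b : ContDiffBump (0 : ℝ) := default
  exact ⟨b, b.contDiff, b.hasCompactSupport,
    b.one_of_mem_closedBall (Metric.mem_closedBall_self b.rIn_pos.le), b.neg, fun _ => b.nonneg,
    fun _ => b.le_one⟩

/-- The involution `φ ↦ conj φ(-·)`, which conjugates the Fourier transform. -/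
def conjReflect (φ : ℝ → ℂ) (t : ℝ) : ℂ := starRingEnd ℂ (φ (-t))

theorem contDiff_conjReflect {φ : ℝ → ℂ} (hφ : ContDiff ℝ ∞ φ) : ContDiff ℝ ∞ (conjReflect φ) :=
  Complex.conjCLE.contDiff.comp (hφ.comp contDiff_neg)

theorem hasCompactSupport_conjReflect {φ : ℝ → ℂ} (hφ : HasCompactSupport φ) :
    HasCompactSupport (conjReflect φ) :=
  (hφ.comp_homeomorph (Homeomorph.neg ℝ)).comp_left (g := starRingEnd ℂ) (map_zero _)

theorem fourier_conjReflect (φ : ℝ → ℂ) (ξ : ℝ) :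
    𝓕 (conjReflect φ) ξ = starRingEnd ℂ (𝓕 φ ξ) := by
  rw [Real.fourier_eq', Real.fourier_eq', ← integral_conj, ← integral_neg_eq_self]
  refine integral_congr_ae (Eventually.of_forall fun t => ?_)
  simp only [conjReflect, neg_neg, smul_eq_mul, map_mul, ← Complex.exp_conj, Complex.conj_I,
    Complex.conj_ofReal]
  congr 2
  simp

theorem contDiff_convolution {η φ : ℝ → ℂ} (hη : ContDiff ℝ ∞ η) (hηc : HasCompactSupport η)
    (hφ : LocallyIntegrable φ) : ContDiff ℝ ∞ (η ⋆[lsmul ℂ ℂ] φ) :=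
  hηc.contDiff_convolution_left (lsmul ℝ ℂ) hη hφ

/-- The involution conjugates the transform, so the convolution theorem gives a squared modulus. Its
positivity prevents cancellation in sums, and the identity also yields the sup bound for chirps. -/
theorem fourier_conjReflect_convolution {φ : ℝ → ℂ} (hφ : Integrable φ) (ξ : ℝ) :
    𝓕 (conjReflect φ ⋆[lsmul ℂ ℂ] φ) ξ = (‖𝓕 φ ξ‖ ^ 2 : ℝ) := by
  have hc : Integrable (conjReflect φ) :=
    (LinearIsometryEquiv.integrable_comp_iff Complex.conjLIE).2 hφ.comp_neg
  rw [Real.fourier_smul_convolution_eq hc hφ, fourier_conjReflect, smul_eq_mul,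
    Complex.conj_mul']
  push_cast
  rfl

/-- A smooth function with compact support is the Fourier transform of a convolution `h * φ`
whenever the Fourier transform of `φ` does not vanish on its support. -/
theorem exists_schwartz_convolution_eq {φ : ℝ → ℂ} (hφ : ContDiff ℝ ∞ φ)
    (hφc : HasCompactSupport φ) (χ : 𝓢(ℝ, ℂ)) (hχ : HasCompactSupport χ)
    (hne : ∀ ξ ∈ tsupport χ, 𝓕 φ ξ ≠ 0) :
    ∃ h : 𝓢(ℝ, ℂ), ((h : ℝ → ℂ) ⋆[lsmul ℂ ℂ] φ) = ⇑(𝓕⁻ χ : 𝓢(ℝ, ℂ)) := by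
  set Φ : 𝓢(ℝ, ℂ) := hφc.toSchwartzMap hφ
  have hΦ : ∀ ξ, 𝓕 Φ ξ = 𝓕 φ ξ := fun ξ => by rw [SchwartzMap.fourier_coe]; rfl
  -- Zeros of `𝓕 Φ` lie off the closed support of `χ`, where the quotient is locally `0`.
  have hq : ContDiff ℝ ∞ fun ξ => χ ξ / 𝓕 Φ ξ := by
    refine contDiff_iff_contDiffAt.2 fun ξ => ?_
    by_cases hξ : ξ ∈ tsupport χ
    · simp only [div_eq_mul_inv]
      exact (χ.smooth ⊤).contDiffAt.mul
        (((𝓕 Φ).smooth ⊤).contDiffAt.inv (by rw [hΦ]; exact hne ξ hξ))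
    · refine (contDiffAt_const (c := (0 : ℂ))).congr_of_eventuallyEq ?_
      filter_upwards [(isClosed_tsupport χ).isOpen_compl.mem_nhds hξ] with y hy
      rw [image_eq_zero_of_notMem_tsupport hy, zero_div]
  have hqc : HasCompactSupport fun ξ => χ ξ / 𝓕 Φ ξ := by
    simp only [div_eq_mul_inv]
    exact hχ.mul_right
  refine ⟨𝓕⁻ (hqc.toSchwartzMap hq), ?_⟩
  have key : SchwartzMap.convolution (lsmul ℂ ℂ) (𝓕⁻ (hqc.toSchwartzMap hq)) Φ = 𝓕⁻ χ := by
    rw [← (FourierTransform.fourierEquiv ℂ 𝓢(ℝ, ℂ)).injective.eq_iff]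
    simp only [FourierTransform.fourierEquiv_apply, SchwartzMap.fourier_convolution]
    ext ξ
    simp
    by_cases hξ : ξ ∈ tsupport χ
    · rw [div_mul_cancel₀]
      rw [hΦ]; exact hne ξ hξ
    · rw [image_eq_zero_of_notMem_tsupport hξ, zero_div, zero_mul]
  funext x
  rw [← key, SchwartzMap.convolution_apply]
  rfl

theorem fourierInv_comp_div {χ : ℝ → ℂ} {R : ℝ} (hR : 0 < R) (t : ℝ) :
    𝓕⁻ (fun ξ => χ (ξ / R)) t = R * 𝓕⁻ χ (R * t) := by
  rw [Real.fourierInv_eq', Real.fourierInv_eq']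
  have := Measure.integral_comp_div
    (fun u : ℝ => Complex.exp (((2 * Real.pi * (inner ℝ u (R * t)) : ℝ) : ℂ) * Complex.I) • χ u) R
  rw [abs_of_pos hR, Complex.real_smul] at this
  rw [← this]
  refine integral_congr_ae (Eventually.of_forall fun u => ?_)
  simp only [RCLike.inner_apply, conj_trivial]
  congr 5
  field_simp

/-! ### Band-limited approximation and the Wiener-type argument. -/

/-- A uniformly continuous function is uniformly approximated by its convolutions with band-limited
Schwartz functions. -/
theorem exists_bandLimited_convolution_close [CompleteSpace X] {G : ℝ → X}
    (hG : UniformContinuous G) {ε : ℝ} (hε : 0 < ε) :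
    ∃ χ : 𝓢(ℝ, ℂ), HasCompactSupport χ ∧
      ∀ t, ‖((𝓕⁻ χ : 𝓢(ℝ, ℂ)) ⋆[lsmul ℂ ℂ] G) t - G t‖ ≤ ε := by
  obtain ⟨χ₀, hχ₀, hχ₀1⟩ : ∃ χ₀ : 𝓢(ℝ, ℂ), HasCompactSupport χ₀ ∧ χ₀ 0 = 1 := by
    obtain ⟨b, hb, hbc, hb1, -⟩ := exists_even_bump
    have hc : HasCompactSupport fun x => ((b x : ℝ) : ℂ) := hbc.comp_left Complex.ofReal_zero
    exact ⟨hc.toSchwartzMap (Complex.ofRealCLM.contDiff.comp hb), hc, congrArg Complex.ofReal hb1⟩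
  set ρ : 𝓢(ℝ, ℂ) := 𝓕⁻ χ₀ with hρ
  have hρ1 : ∫ u, ρ u = 1 := by
    have h1 : 𝓕 ρ 0 = 1 := by rw [hρ, FourierTransform.fourier_fourierInv_eq, hχ₀1]
    rw [SchwartzMap.fourier_coe, Real.fourier_eq'] at h1
    simpa using h1
  set M₀ := ∫ u, ‖ρ u‖
  set M₁ := ∫ u, ‖u‖ ^ 1 * ‖ρ u‖
  have hM₀ : 0 ≤ M₀ := integral_nonneg fun _ => norm_nonneg _
  have hM₁ : 0 ≤ M₁ := integral_nonneg fun _ => by positivity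
  -- For the kernel `R ρ(R s)` the error is at most `ε / (2 (M₀ + 1)) * M₀ + C / R * M₁`; this
  -- choice and that of `R` make each term at most `ε / 2`.
  obtain ⟨C, hC, hinc⟩ := exists_increment_bound hG (show 0 < ε / (2 * (M₀ + 1)) by positivity)
  set R := 2 * (C * M₁ + 1) / ε with hR'
  have hR : 0 < R := by positivity
  have hc : HasCompactSupport fun ξ => χ₀ (ξ / R) := by
    simp only [div_eq_mul_inv]
    exact hχ₀.comp_homeomorph (Homeomorph.mulRight₀ R⁻¹ (by positivity))
  refine ⟨hc.toSchwartzMap ((χ₀.smooth ⊤).comp (contDiff_id.div_const R)), hc, fun t => ?_⟩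
  have hdil : ∀ s, (𝓕⁻ (hc.toSchwartzMap ((χ₀.smooth ⊤).comp (contDiff_id.div_const R))) :
      𝓢(ℝ, ℂ)) s = R * ρ (R * s) := fun s => by
    rw [SchwartzMap.fourierInv_coe, hρ, SchwartzMap.fourierInv_coe]
    exact fourierInv_comp_div hR s
  have hbound : ∀ u, ‖ρ u • (G (t - u / R) - G t)‖ ≤
      ε / (2 * (M₀ + 1)) * ‖ρ u‖ + C / R * (‖u‖ ^ 1 * ‖ρ u‖) := fun u => by
    rw [norm_smul]
    have := mul_le_mul_of_nonneg_left (hinc t (u / R)) (norm_nonneg (ρ u))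
    rw [abs_div, abs_of_pos hR] at this
    refine this.trans (le_of_eq ?_)
    rw [pow_one, Real.norm_eq_abs u]
    ring
  have hdomi : Integrable fun u => ε / (2 * (M₀ + 1)) * ‖ρ u‖ + C / R * (‖u‖ ^ 1 * ‖ρ u‖) :=
    (ρ.integrable.norm.const_mul _).add ((ρ.integrable_pow_mul volume 1).const_mul _)
  have hdiff : Integrable fun u => ρ u • (G (t - u / R) - G t) := by
    refine hdomi.mono' ?_ (Eventually.of_forall hbound)
    have := hG.continuous
    exact Continuous.aestronglyMeasurable (by fun_prop)
  have hconst : Integrable fun u => ρ u • G t := ρ.integrable.smul_const _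
  have heq : ((𝓕⁻ (hc.toSchwartzMap ((χ₀.smooth ⊤).comp (contDiff_id.div_const R))) :
      𝓢(ℝ, ℂ)) ⋆[lsmul ℂ ℂ] G) t - G t = ∫ u, ρ u • (G (t - u / R) - G t) := by
    have h1 := Measure.integral_comp_mul_left (fun u => ρ u • G (t - u / R)) R
    have h2 : ∫ u, ρ u • G t = G t := by rw [integral_smul_const, hρ1, one_smul]
    have h3 : ∫ u, ρ u • G (t - u / R) = (∫ u, ρ u • (G (t - u / R) - G t)) + G t := by
      refine Eq.trans ?_ (congrArg (_ + ·) h2)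
      rw [← integral_add hdiff hconst]
      simp only [smul_sub, sub_add_cancel]
    rw [sub_eq_iff_eq_add, ← h3, convolution_def]
    simp only [lsmul_apply, hdil, mul_smul, integral_smul]
    simp only [mul_div_cancel_left₀ _ hR.ne'] at h1
    rw [h1, abs_of_pos (inv_pos.2 hR), Complex.coe_smul, smul_inv_smul₀ hR.ne']
  rw [heq]
  refine (norm_integral_le_of_norm_le hdomi (Eventually.of_forall hbound)).trans ?_
  rw [integral_add (ρ.integrable.norm.const_mul _) ((ρ.integrable_pow_mul volume 1).const_mul _),
    integral_const_mul, integral_const_mul]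
  have h4 : ε / (2 * (M₀ + 1)) * M₀ ≤ ε / 2 := by
    rw [div_mul_eq_mul_div, div_le_div_iff₀ (by positivity) (by positivity)]
    nlinarith
  have h5 : C / R * M₁ ≤ ε / 2 := by
    rw [hR', div_div_eq_mul_div, div_mul_eq_mul_div, div_le_div_iff₀ (by positivity) (by positivity)]
    nlinarith
  linarith

/-- If the Fourier transforms of the test functions `φ` for which `φ * F` vanishes at infinity have
no common zero, then on any given compact set one of them has no zero. -/
theorem exists_fourier_pos_on_compact [CompleteSpace X] {F : ℝ → X} (hF : LocallyIntegrable F)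
    (h : ∀ ξ, ∃ φ : ℝ → ℂ, ContDiff ℝ ∞ φ ∧ HasCompactSupport φ ∧
      Tendsto (φ ⋆[lsmul ℂ ℂ] F) (cocompact ℝ) (𝓝 0) ∧ 𝓕 φ ξ ≠ 0) {K : Set ℝ} (hK : IsCompact K) :
    ∃ φ : ℝ → ℂ, ContDiff ℝ ∞ φ ∧ HasCompactSupport φ ∧
      Tendsto (φ ⋆[lsmul ℂ ℂ] F) (cocompact ℝ) (𝓝 0) ∧ (∀ ξ, 0 ≤ 𝓕 φ ξ) ∧ ∀ ξ ∈ K, 𝓕 φ ξ ≠ 0 := by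
  have hint : ∀ φ : ℝ → ℂ, ContDiff ℝ ∞ φ → HasCompactSupport φ → Integrable φ :=
    fun φ h1 h2 => h1.continuous.integrable_of_hasCompactSupport h2
  refine hK.induction_on ?_ ?_ ?_ ?_
  · refine ⟨0, contDiff_const, HasCompactSupport.zero, ?_, ?_, by simp⟩
    · rw [zero_convolution]
      exact tendsto_const_nhds
    · intro ξ
      simp [Real.fourier_eq']
  · rintro s t hst ⟨φ, h1, h2, h3, h4, h5⟩
    exact ⟨φ, h1, h2, h3, h4, fun ξ hξ => h5 ξ (hst hξ)⟩
  -- Both transforms are nonnegative, so their sum vanishes only at common zeros.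
  · rintro s t ⟨φ, h1, h2, h3, h4, h5⟩ ⟨ψ, g1, g2, g3, g4, g5⟩
    have hadd : ∀ ξ, 𝓕 (φ + ψ) ξ = 𝓕 φ ξ + 𝓕 ψ ξ := fun ξ => by
      simp only [Real.fourier_eq, Pi.add_apply, smul_add]
      exact integral_add ((Real.fourierIntegral_convergent_iff ξ).2 (hint φ h1 h2))
        ((Real.fourierIntegral_convergent_iff ξ).2 (hint ψ g1 g2))
    refine ⟨φ + ψ, h1.add g1, h2.add g2, ?_, fun ξ => ?_, fun ξ hξ h0 => ?_⟩
    · rw [ConvolutionExists.add_distrib (h2.convolutionExists_left _ h1.continuous hF)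
        (g2.convolutionExists_left _ g1.continuous hF)]
      have h6 := h3.add g3
      rw [add_zero] at h6
      exact h6
    · rw [hadd]
      exact add_nonneg (h4 ξ) (g4 ξ)
    · rw [hadd] at h0
      obtain ⟨h6, h7⟩ := (add_eq_zero_iff_of_nonneg (h4 ξ) (g4 ξ)).1 h0
      exact hξ.elim (fun h' => h5 ξ h' h6) fun h' => g5 ξ h' h7
  · intro ξ _
    obtain ⟨φ, h1, h2, h3, h4⟩ := h ξ
    have hcont : Continuous (𝓕 φ) := by
      have := (𝓕 (h2.toSchwartzMap h1)).continuous
      rwa [SchwartzMap.fourier_coe] at this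
    have hsq := fourier_conjReflect_convolution (hint φ h1 h2)
    refine ⟨{η | 𝓕 φ η ≠ 0}, mem_nhdsWithin_of_mem_nhds (hcont.continuousAt.eventually_ne h4),
      conjReflect φ ⋆[lsmul ℂ ℂ] φ, ?_, ?_, ?_, fun η => ?_, fun η hη => ?_⟩
    · exact contDiff_convolution (contDiff_conjReflect h1) (hasCompactSupport_conjReflect h2)
        (hint φ h1 h2).locallyIntegrable
    · exact (hasCompactSupport_conjReflect h2).convolution _ h2
    · rw [convolution_assoc_compact (contDiff_conjReflect h1).continuous
        (hasCompactSupport_conjReflect h2) h1.continuous h2 hF]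
      exact tendsto_convolution_cocompact (hint _ (contDiff_conjReflect h1)
        (hasCompactSupport_conjReflect h2)) (h2.continuous_convolution_left _ h1.continuous hF) h3
    · rw [hsq]
      exact Complex.zero_le_real.2 (sq_nonneg _)
    · rw [hsq]
      simpa using hη

/-- A uniformly continuous convolution `ψ * F` vanishes at infinity as soon as the Fourier
transforms of the test functions `φ` for which `φ * F` vanishes at infinity have no common zero. -/
theorem tendsto_convolution_of_forall_exists [CompleteSpace X] {F : ℝ → X}
    (hF : LocallyIntegrable F)
    (h : ∀ ξ, ∃ φ : ℝ → ℂ, ContDiff ℝ ∞ φ ∧ HasCompactSupport φ ∧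
      Tendsto (φ ⋆[lsmul ℂ ℂ] F) (cocompact ℝ) (𝓝 0) ∧ 𝓕 φ ξ ≠ 0)
    {ψ : ℝ → ℂ} (hψ : Continuous ψ) (hψc : HasCompactSupport ψ)
    (hG : UniformContinuous (ψ ⋆[lsmul ℂ ℂ] F)) :
    Tendsto (ψ ⋆[lsmul ℂ ℂ] F) (cocompact ℝ) (𝓝 0) := by
  set G := ψ ⋆[lsmul ℂ ℂ] F
  obtain ⟨C, -, hC⟩ := exists_increment_bound hG one_pos
  -- `G` is not known to be bounded; linear growth suffices for associativity with Schwartz kernels.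
  have hgrowth : ∀ t, ‖G t‖ ≤ (‖G 0‖ + 1) + C * |t| := fun t => by
    have h1 := hC 0 (-t)
    rw [abs_neg, sub_neg_eq_add, zero_add] at h1
    have h2 := norm_sub_norm_le (G t) (G 0)
    linarith
  refine Metric.tendsto_nhds.2 fun ε hε => ?_
  obtain ⟨χ, hχ, hclose⟩ := exists_bandLimited_convolution_close hG (half_pos hε)
  obtain ⟨φ, h1, h2, h3, -, h5⟩ := exists_fourier_pos_on_compact hF h hχ.isCompact
  obtain ⟨k, hk⟩ := exists_schwartz_convolution_eq h1 h2 χ hχ h5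
  have hφG : Tendsto (φ ⋆[lsmul ℂ ℂ] G) (cocompact ℝ) (𝓝 0) := by
    rw [convolution_left_comm h1.continuous h2 hψ hψc hF]
    exact tendsto_convolution_cocompact (hψ.integrable_of_hasCompactSupport hψc)
      (h2.continuous_convolution_left _ h1.continuous hF) h3
  have hlim : Tendsto ((𝓕⁻ χ : 𝓢(ℝ, ℂ)) ⋆[lsmul ℂ ℂ] G) (cocompact ℝ) (𝓝 0) := by
    rw [← hk, convolution_assoc_schwartz k h1.continuous h2 hG.continuous hgrowth]
    exact tendsto_convolution_cocompact k.integrable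
      (h2.continuous_convolution_left _ h1.continuous hG.continuous.locallyIntegrable) hφG
  filter_upwards [Metric.tendsto_nhds.1 hlim _ (half_pos hε)] with t ht
  rw [dist_zero_right] at ht ⊢
  have h6 := hclose t
  have h7 := norm_sub_norm_le (G t) (((𝓕⁻ χ : 𝓢(ℝ, ℂ)) ⋆[lsmul ℂ ℂ] G) t)
  rw [norm_sub_rev] at h7
  linarith

/-! ### Passage between `J` and the whole line. -/

theorem isClosed_of_eq_univ_or_Ici {J : Set ℝ} (hJ : J = Set.univ ∨ J = Set.Ici 0) :
    IsClosed J := by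
  rcases hJ with rfl | rfl
  exacts [isClosed_univ, isClosed_Ici]

theorem locallyIntegrable_indicator {E : Type*} [NormedAddCommGroup E] {J : Set ℝ}
    (hJ : IsClosed J) {F : ℝ → E} (hF : LocallyIntegrableOn F J) :
    LocallyIntegrable (J.indicator F) := by
  rw [locallyIntegrable_iff]
  intro K hK
  rw [IntegrableOn, integrable_indicator_iff hJ.measurableSet, IntegrableOn,
    Measure.restrict_restrict hJ.measurableSet]
  exact hF.integrableOn_compact_subset Set.inter_subset_left (hK.inter_left hJ)

theorem continuous_extConv {J : Set ℝ} (hJ : IsClosed J) {F : ℝ → X}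
    (hF : LocallyIntegrableOn F J) {φ : ℝ → ℂ} (hφ : Continuous φ) (hφc : HasCompactSupport φ) :
    Continuous (extConv J F φ) :=
  hφc.continuous_convolution_left _ hφ (locallyIntegrable_indicator hJ hF)

/-- Outside of `J`, the function `F̄ * φ` vanishes far to the left. -/
theorem exists_extConv_eq_zero {J : Set ℝ} (hJ : J = Set.univ ∨ J = Set.Ici 0) (F : ℝ → X)
    {φ : ℝ → ℂ} (hφc : HasCompactSupport φ) :
    ∃ R, 0 < R ∧ ∀ t ∉ J, t ≤ -R → extConv J F φ t = 0 := by
  obtain ⟨R, hR, hsub⟩ := hφc.isCompact.isBounded.subset_closedBall_lt 0 (0 : ℝ)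
  refine ⟨R + 1, by linarith, fun t ht htR => ?_⟩
  rcases hJ with rfl | rfl
  · exact absurd (Set.mem_univ t) ht
  · rw [extConv, convolution_def]
    refine integral_eq_zero_of_ae (Eventually.of_forall fun s => ?_)
    by_cases hs : s ∈ tsupport φ
    · have h1 := hsub hs
      rw [mem_closedBall_zero_iff, Real.norm_eq_abs] at h1
      have h2 : t - s ∉ Set.Ici (0 : ℝ) := by
        rw [Set.mem_Ici, not_le]
        linarith [neg_abs_le s]
      simp [Set.indicator_of_notMem h2]
    · simp [image_eq_zero_of_notMem_tsupport hs]

/-- A function on `J` vanishes at infinity iff it does so along the trace on `J` of the filter of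
neighbourhoods of infinity. -/
theorem domRestrict_mem_C0_iff {E : Type*} [NormedAddCommGroup E] {J : Set ℝ} (hJ : IsClosed J)
    {k : ℝ → E} (hk : Continuous k) :
    J.domRestrict k ∈ C0 J E ↔ Tendsto k (cocompact ℝ ⊓ 𝓟 J) (𝓝 0) := by
  have hco : cocompact J = comap ((↑) : J → ℝ) (cocompact ℝ) :=
    le_antisymm hJ.isClosedEmbedding_subtypeVal.tendsto_cocompact.le_comap
      (comap_cocompact_le continuous_subtype_val)
  have hiff : Tendsto k (cocompact ℝ ⊓ 𝓟 J) (𝓝 0) ↔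
      Tendsto (J.domRestrict k) (cocompact J) (𝓝 0) := by
    have hm : map ((↑) : J → ℝ) (comap (↑) (cocompact ℝ)) = cocompact ℝ ⊓ 𝓟 J := by
      rw [map_comap, Subtype.range_coe]
    rw [hco, ← hm, tendsto_map'_iff]
    rfl
  rw [hiff]
  constructor
  · rintro ⟨g, hg⟩
    rw [← hg]
    exact g.zero_at_infty'
  · intro h
    exact ⟨⟨⟨J.domRestrict k, hk.comp continuous_subtype_val⟩, h⟩, rfl⟩

theorem tendsto_extConv_of_mem_C0 {J : Set ℝ} (hJ : J = Set.univ ∨ J = Set.Ici 0) {F : ℝ → X}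
    (hF : LocallyIntegrableOn F J) {φ : ℝ → ℂ} (hφ : Continuous φ) (hφc : HasCompactSupport φ)
    (h : J.domRestrict (extConv J F φ) ∈ C0 J X) :
    Tendsto (extConv J F φ) (cocompact ℝ) (𝓝 0) := by
  have hcl := isClosed_of_eq_univ_or_Ici hJ
  rw [domRestrict_mem_C0_iff hcl (continuous_extConv hcl hF hφ hφc)] at h
  obtain ⟨R, hR, hz⟩ := exists_extConv_eq_zero hJ F hφc
  have h2 : Tendsto (extConv J F φ) (cocompact ℝ ⊓ 𝓟 Jᶜ) (𝓝 0) := by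
    refine tendsto_const_nhds.congr' ?_
    rw [EventuallyEq, eventually_inf_principal]
    filter_upwards [(isCompact_Icc (a := -R) (b := 0)).compl_mem_cocompact] with t ht htJ
    refine (hz t htJ ?_).symm
    rcases hJ with rfl | rfl
    · exact absurd (Set.mem_univ t) htJ
    · by_contra hcon
      exact ht ⟨(not_le.1 hcon).le, (not_le.1 (Set.mem_Ici.not.1 htJ)).le⟩
  have := h.sup h2
  rwa [← inf_sup_left, sup_principal, Set.union_compl_self, principal_univ, inf_top_eq] at this

theorem uniformContinuous_extConv {J : Set ℝ} (hJ : J = Set.univ ∨ J = Set.Ici 0) {F : ℝ → X}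
    (hF : LocallyIntegrableOn F J) {φ : ℝ → ℂ} (hφ : Continuous φ) (hφc : HasCompactSupport φ)
    (h : UniformContinuousOn (extConv J F φ) J) : UniformContinuous (extConv J F φ) := by
  have hcont := continuous_extConv (isClosed_of_eq_univ_or_Ici hJ) hF hφ hφc
  obtain ⟨R, hR, hz⟩ := exists_extConv_eq_zero hJ F hφc
  set k := extConv J F φ
  rcases hJ with rfl | rfl
  · exact uniformContinuousOn_univ.1 h
  · have h1 : UniformContinuous fun t => k (max t 0) :=
      uniformContinuousOn_univ.1 (h.comp (t := Set.Ici 0) (f := fun t : ℝ => max t 0)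
        (LipschitzWith.id.max_const 0).uniformContinuous.uniformContinuousOn
        fun t _ => le_max_right t 0)
    have h2 : UniformContinuous fun t => k (max (min t 0) (-R)) := by
      have hK := isCompact_Icc.uniformContinuousOn_of_continuous
        (hcont.continuousOn (s := Set.Icc (-R) 0))
      refine uniformContinuousOn_univ.1 (hK.comp (f := fun t : ℝ => max (min t 0) (-R))
        ((LipschitzWith.id.min_const 0).max_const (-R)).uniformContinuous.uniformContinuousOn
        fun t _ => ⟨le_max_right _ _, max_le (min_le_right _ _) (by linarith)⟩)
    -- Clamping to `[0, ∞)` and `[-R, 0]` glues the two pieces, which overlap at `0`; left of `-R`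
    -- the function is zero.
    have h3 : k = fun t => k (max t 0) + k (max (min t 0) (-R)) - k 0 := by
      funext t
      rcases le_total 0 t with ht | ht
      · simp [ht, hR.le]
      · rw [max_eq_right ht, min_eq_left ht, add_sub_cancel_left]
        rcases le_total (-R) t with ht' | ht'
        · rw [max_eq_left ht']
        · rw [max_eq_right ht']
          have hRz : ∀ s ≤ -R, k s = 0 := by
            intro s hs
            exact hz s (fun h0 => by linarith [Set.mem_Ici.1 h0]) hs
          rw [hRz t ht', hRz (-R) le_rfl]
    rw [h3]
    exact (h1.add h2).sub uniformContinuous_const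

theorem exists_C0_eq_extConv [CompleteSpace X] {J : Set ℝ} (hJ : J = Set.univ ∨ J = Set.Ici 0)
    {F : ℝ → X} (hF : LocallyIntegrableOn F J)
    (hsp : reducedSpectrum J (C0 J X) testFns F = ∅) (ψ : TestFn)
    (hψ : UniformContinuousOn (extConv J F ψ) J) :
    ∃ g : C₀(ℝ, X), (g : ℝ → X) = extConv J F ψ := by
  have hcl := isClosed_of_eq_univ_or_Ici hJ
  refine ⟨⟨⟨extConv J F ψ, continuous_extConv hcl hF ψ.continuous ψ.hasCompactSupport⟩, ?_⟩, rfl⟩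
  refine tendsto_convolution_of_forall_exists (locallyIntegrable_indicator hcl hF) (fun ξ => ?_)
    ψ.continuous ψ.hasCompactSupport
    (uniformContinuous_extConv hJ hF ψ.continuous ψ.hasCompactSupport hψ)
  -- The factor `2π` matches the normalisation of `hat` with that of `𝓕`.
  have hξ : 2 * Real.pi * ξ ∉ reducedSpectrum J (C0 J X) testFns F := by simp [hsp]
  simp only [reducedSpectrum, Set.mem_ofPred_eq, not_forall] at hξ
  obtain ⟨φ, hφ, hmem, hne⟩ := hξ
  obtain ⟨h1, h2⟩ := mem_testFns_iff.1 hφ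
  refine ⟨φ, h1, h2, tendsto_extConv_of_mem_C0 hJ hF h1.continuous h2 hmem, ?_⟩
  rwa [hat_eq_fourier, mul_div_cancel_left₀ _ (by positivity)] at hne

/-! ### Functions in `Lᵖ`. -/

/-- The Hölder inequality for convolutions. -/
theorem norm_convolution_le_eLpNorm {φ : ℝ → ℂ} (hφ : AEStronglyMeasurable φ) {u : ℝ → X}
    (hu : AEStronglyMeasurable u) {p q : ℝ≥0∞} [hpq : ENNReal.HolderConjugate p q] (t : ℝ) :
    ‖(φ ⋆[lsmul ℂ ℂ] u) t‖ₑ ≤ eLpNorm φ q volume * eLpNorm u p volume := by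
  have hmp : MeasurePreserving (fun s : ℝ => t - s) volume volume :=
    Measure.measurePreserving_sub_left volume t
  have : ENNReal.HolderTriple q p 1 := hpq.symm
  calc ‖(φ ⋆[lsmul ℂ ℂ] u) t‖ₑ ≤ ∫⁻ s, ‖φ s • u (t - s)‖ₑ := enorm_integral_le_lintegral_enorm _
    _ = eLpNorm (φ • fun s => u (t - s)) 1 volume := by rw [eLpNorm_one_eq_lintegral_enorm]; rfl
    _ ≤ eLpNorm φ q volume * eLpNorm (fun s => u (t - s)) p volume :=
      eLpNorm_smul_le_mul_eLpNorm (hu.comp_measurePreserving hmp) hφ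
    _ = _ := by rw [← eLpNorm_comp_measurePreserving hu hmp]; rfl

/-- Approximate `u` in `Lᵖ` by `g` of compact support: `φ * g` has compact support, and Hölder
bounds `φ * (u - g)` uniformly. -/
theorem tendsto_convolution_of_memLp {p : ℝ≥0∞} (hp : 1 ≤ p) (hp' : p ≠ ⊤) {u : ℝ → X}
    (hu : MemLp u p volume) {φ : ℝ → ℂ} (hφ : Continuous φ) (hφc : HasCompactSupport φ) :
    Tendsto (φ ⋆[lsmul ℂ ℂ] u) (cocompact ℝ) (𝓝 0) := by
  have hpq : ENNReal.HolderConjugate p p.conjExponent := .conjExponent hp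
  have hN : eLpNorm φ p.conjExponent volume ≠ ⊤ :=
    (hφ.memLp_of_hasCompactSupport hφc).eLpNorm_ne_top
  rw [Metric.tendsto_nhds]
  intro ε hε
  obtain ⟨δ, hδ, hlt⟩ := ENNReal.exists_pos_mul_lt hN (ENNReal.ofReal_pos.2 hε).ne'
  obtain ⟨g, hgc, hgd, hg, hgp⟩ :=
    hu.exists_hasCompactSupport_eLpNorm_sub_le hp' (ε := δ) (by positivity)
  filter_upwards [(hφc.convolution (lsmul ℂ ℂ) hgc (μ := volume)).isCompact.compl_mem_cocompact]
    with t ht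
  have hz : (φ ⋆[lsmul ℂ ℂ] g) t = 0 := image_eq_zero_of_notMem_tsupport ht
  have heq : (φ ⋆[lsmul ℂ ℂ] u) t = (φ ⋆[lsmul ℂ ℂ] (u - g)) t := by
    have h1 := (hφc.convolutionExists_left (lsmul ℂ ℂ) hφ
      ((hu.sub hgp).locallyIntegrable hp) t).distrib_add
      (hφc.convolutionExists_left (lsmul ℂ ℂ) hφ hg.locallyIntegrable t)
    rwa [sub_add_cancel, hz, add_zero] at h1
  rw [dist_zero_right, heq]
  have h2 := (norm_convolution_le_eLpNorm hφ.aestronglyMeasurable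
    (hu.sub hgp).aestronglyMeasurable t).trans_lt ((mul_le_mul_right hgd _).trans_lt
      (by simpa [mul_comm] using hlt))
  rwa [← ofReal_norm, ENNReal.ofReal_lt_ofReal_iff hε] at h2

/-- Modulating a bump by `e^{iwt}` moves its positive integral to frequency `w`. -/
theorem exists_testFn_hat_ne_zero (w : ℝ) : ∃ φ ∈ testFns, hat φ w ≠ 0 := by
  obtain ⟨b, hb, hbc, hb1, -, hb0, -⟩ := exists_even_bump
  refine ⟨fun t => Complex.exp (Complex.I * w * t) * (b t : ℂ), mem_testFns_iff.2 ⟨?_, ?_⟩, ?_⟩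
  · exact ((contDiff_const.mul Complex.ofRealCLM.contDiff).cexp).mul
      (Complex.ofRealCLM.contDiff.comp hb)
  · exact (hbc.comp_left Complex.ofReal_zero).mul_left
  · have h1 : ∀ t : ℝ, Complex.exp (-(Complex.I * w * t)) *
        (Complex.exp (Complex.I * w * t) * (b t : ℂ)) = (b t : ℂ) := fun t => by
      rw [← mul_assoc, ← Complex.exp_add, neg_add_cancel, Complex.exp_zero, one_mul]
    simp only [hat, h1, integral_complex_ofReal]
    exact Complex.ofReal_ne_zero.2 (hb.continuous.integral_pos_of_hasCompactSupport_nonneg_nonzero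
      hbc hb0 (x := 0) (by simp [hb1])).ne'

theorem memLp_reducedSpectrum_eq_empty {J : Set ℝ} (hJ : IsClosed J) {p : ℝ≥0∞} (hp : 1 ≤ p)
    (hp' : p ≠ ⊤) {F : ℝ → X} (hF : MemLp F p (volume.restrict J)) :
    LocallyIntegrableOn F J ∧ reducedSpectrum J (C0 J X) testFns F = ∅ ∧
      ∀ ψ : TestFn, UniformContinuousOn (extConv J F ψ) J := by
  have hloc : LocallyIntegrableOn F J :=
    locallyIntegrableOn_of_locallyIntegrable_restrict (hF.locallyIntegrable hp)
  have hF' : MemLp (J.indicator F) p volume := (memLp_indicator_iff_restrict hJ.measurableSet).2 hF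
  have hten : ∀ φ : ℝ → ℂ, Continuous φ → HasCompactSupport φ →
      Tendsto (extConv J F φ) (cocompact ℝ) (𝓝 0) := fun φ h1 h2 =>
    tendsto_convolution_of_memLp hp hp' hF' h1 h2
  refine ⟨hloc, Set.eq_empty_of_forall_notMem fun w hw => ?_, fun ψ => ?_⟩
  · obtain ⟨φ, hφ, hne⟩ := exists_testFn_hat_ne_zero w
    obtain ⟨h1, h2⟩ := mem_testFns_iff.1 hφ
    refine hne (hw φ hφ ?_)
    rw [domRestrict_mem_C0_iff hJ (continuous_extConv hJ hloc h1.continuous h2)]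
    exact (hten φ h1.continuous h2).mono_left inf_le_left
  · exact ((continuous_extConv hJ hloc ψ.continuous
      ψ.hasCompactSupport).uniformContinuous_of_tendsto_cocompact
      (hten ψ ψ.continuous ψ.hasCompactSupport)).uniformContinuousOn

/-! ### Chirps and the sup norm of their transforms. -/

/-- The chirp `b(t) e^{int²}`. -/
noncomputable def chirp (b : ℝ → ℝ) (n : ℕ) (t : ℝ) : ℂ := b t * Complex.exp (Complex.I * n * t ^ 2)

theorem contDiff_chirp {b : ℝ → ℝ} (hb : ContDiff ℝ ∞ b) (n : ℕ) : ContDiff ℝ ∞ (chirp b n) :=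
  (Complex.ofRealCLM.contDiff.comp hb).mul
    (contDiff_const.mul (Complex.ofRealCLM.contDiff.pow 2)).cexp

theorem hasCompactSupport_chirp {b : ℝ → ℝ} (hb : HasCompactSupport b) (n : ℕ) :
    HasCompactSupport (chirp b n) :=
  (hb.comp_left Complex.ofReal_zero).mul_right

theorem norm_chirp (b : ℝ → ℝ) (n : ℕ) (t : ℝ) : ‖chirp b n t‖ = |b t| := by
  rw [chirp, norm_mul, Complex.norm_real, Real.norm_eq_abs,
    show Complex.I * n * (t : ℂ) ^ 2 = ((n * t ^ 2 : ℝ) : ℂ) * Complex.I by push_cast; ring,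
    Complex.norm_exp_ofReal_mul_I, mul_one]

theorem chirp_neg {b : ℝ → ℝ} (hb : ∀ t, b (-t) = b t) (n : ℕ) (t : ℝ) :
    chirp b n (-t) = chirp b n t := by
  simp [chirp, hb]

/-- Since `(u + s)² - s² = u² + 2us`, the phase is linear in `s`: a Fourier integral at a frequency
proportional to `nu` remains. -/
theorem conjReflect_convolution_chirp (b : ℝ → ℝ) (n : ℕ) (u : ℝ) :
    (conjReflect (chirp b n) ⋆[lsmul ℂ ℂ] chirp b n) u =
      Complex.exp (Complex.I * n * u ^ 2) *
        ∫ s, Real.fourierChar (-(s * (-(u / Real.pi) * n))) • ((b s * b (u + s) : ℝ) : ℂ) := by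
  rw [convolution_def, ← integral_neg_eq_self, ← integral_const_mul]
  refine integral_congr_ae (Eventually.of_forall fun s => ?_)
  have hpi : (Real.pi : ℂ) ≠ 0 := mod_cast Real.pi_ne_zero
  simp only [conjReflect, chirp, neg_neg, lsmul_apply, smul_eq_mul, map_mul, Complex.conj_ofReal,
    ← Complex.exp_conj, Circle.smul_def, Real.fourierChar_apply, sub_neg_eq_add, map_pow,
    Complex.conj_I, map_natCast]
  have h1 : Complex.exp (-Complex.I * n * (s : ℂ) ^ 2) *
      Complex.exp (Complex.I * n * ((u + s : ℝ) : ℂ) ^ 2) = Complex.exp (Complex.I * n * u ^ 2) *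
        Complex.exp (((2 * Real.pi * (-(s * (-(u / Real.pi) * n))) : ℝ) : ℂ) * Complex.I) := by
    rw [← Complex.exp_add, ← Complex.exp_add]
    congr 1
    push_cast
    field_simp
    ring
  push_cast at h1 ⊢
  linear_combination (b s * b (u + s) : ℂ) * h1

/-- The autocorrelations of the chirps `b(t) e^{int²}` tend to zero in `L¹`. -/
theorem tendsto_integral_norm_autocorrelation_chirp {b : ℝ → ℝ} (hb : ContDiff ℝ ∞ b)
    (hbc : HasCompactSupport b) (heven : ∀ t, b (-t) = b t) :
    Tendsto (fun n => ∫ u, ‖(conjReflect (chirp b n) ⋆[lsmul ℂ ℂ] chirp b n) u‖) atTop (𝓝 0) := by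
  have hbi : Integrable fun t => |b t| := (hb.continuous.integrable_of_hasCompactSupport hbc).abs
  rw [← integral_zero ℝ ℝ]
  refine tendsto_integral_of_dominated_convergence ((fun t => |b t|) ⋆[mul ℝ ℝ] fun t => |b t|)
    (fun n => ?_) (hbi.integrable_convolution _ hbi) (fun n => ?_) ?_
  · exact (contDiff_convolution (contDiff_conjReflect (contDiff_chirp hb n))
      (hasCompactSupport_conjReflect (hasCompactSupport_chirp hbc n))
      (contDiff_chirp hb n).continuous.locallyIntegrable).continuous.norm.aestronglyMeasurable
  · refine Eventually.of_forall fun u => ?_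
    rw [norm_norm, convolution_def, convolution_def]
    refine (norm_integral_le_integral_norm _).trans (le_of_eq ?_)
    refine integral_congr_ae (Eventually.of_forall fun s => ?_)
    simp only [lsmul_apply, norm_smul, norm_chirp, conjReflect, RCLike.norm_conj, heven, mul_apply']
  -- Riemann–Lebesgue needs the frequency `-(u / π) n` to escape to infinity, which fails only at `u
  -- = 0`.
  · have hne : ∀ᵐ u : ℝ, u ≠ 0 := by
      rw [ae_iff]
      simp
    filter_upwards [hne] with u hu
    simp only [conjReflect_convolution_chirp, norm_mul]
    have h1 : ∀ n : ℕ, ‖Complex.exp (Complex.I * n * (u : ℂ) ^ 2)‖ = 1 := fun n => by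
      rw [show Complex.I * n * (u : ℂ) ^ 2 = ((n * u ^ 2 : ℝ) : ℂ) * Complex.I by push_cast; ring,
        Complex.norm_exp_ofReal_mul_I]
    simp only [h1, one_mul]
    rw [← norm_zero (E := ℂ)]
    refine Tendsto.norm ?_
    refine (Real.tendsto_integral_exp_smul_cocompact
      (fun s => ((b s * b (u + s) : ℝ) : ℂ))).comp ?_
    have h2 : Tendsto (fun n : ℕ => (n : ℝ)) atTop (cocompact ℝ) :=
      tendsto_natCast_atTop_atTop.mono_right atTop_le_cocompact
    exact (Homeomorph.mulLeft₀ (-(u / Real.pi)) (neg_ne_zero.2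
      (div_ne_zero hu Real.pi_ne_zero))).isClosedEmbedding.tendsto_cocompact.comp h2

theorem norm_sq_fourier_le {φ : ℝ → ℂ} (hφ : Integrable φ) (ξ : ℝ) :
    ‖𝓕 φ ξ‖ ^ 2 ≤ ∫ u, ‖(conjReflect φ ⋆[lsmul ℂ ℂ] φ) u‖ := by
  have h1 := congrArg norm (fourier_conjReflect_convolution hφ ξ)
  rw [Complex.norm_real, Real.norm_of_nonneg (sq_nonneg _)] at h1
  rw [← h1]
  exact VectorFourier.norm_fourierIntegral_le_integral_norm _ _ _ _ _

theorem hat_comp_div (θ : ℝ → ℂ) (w : ℝ) :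
    hat (fun t => ((2 * Real.pi : ℝ) : ℂ)⁻¹ * θ (t / (2 * Real.pi))) w = 𝓕 θ w := by
  have hpi : (0 : ℝ) < 2 * Real.pi := by positivity
  have hpi' : (Real.pi : ℂ) ≠ 0 := mod_cast Real.pi_ne_zero
  have h1 := Measure.integral_comp_div (fun s : ℝ => ((2 * Real.pi : ℝ) : ℂ)⁻¹ *
    (Complex.exp (((-2 * Real.pi * inner ℝ s w : ℝ) : ℂ) * Complex.I) • θ s)) (2 * Real.pi)
  rw [integral_const_mul, integral_const_mul, abs_of_pos hpi, Complex.real_smul,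
    mul_inv_cancel_left₀ (Complex.ofReal_ne_zero.2 hpi.ne')] at h1
  rw [Real.fourier_eq', ← h1, hat, ← integral_const_mul]
  refine integral_congr_ae (Eventually.of_forall fun t => ?_)
  simp only [smul_eq_mul, RCLike.inner_apply, conj_trivial]
  rw [mul_left_comm]
  congr 3
  push_cast
  field_simp

theorem fourier_neg_of_even {θ : ℝ → ℂ} (hθ : ∀ t, θ (-t) = θ t) (ξ : ℝ) :
    𝓕 θ (-ξ) = 𝓕 θ ξ := by
  rw [Real.fourier_eq', Real.fourier_eq', ← integral_neg_eq_self]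
  simp [hθ]

/-- Evenness puts half of the mass on the half-line, so Plancherel's lower bound survives
restriction to `J`; hence the choice of an even bump. -/
theorem half_integral_le_setIntegral {J : Set ℝ} (hJ : J = Set.univ ∨ J = Set.Ici 0) {f : ℝ → ℝ}
    (hf0 : ∀ t, 0 ≤ f t) (hf : ∀ t, f (-t) = f t) : (∫ t, f t) / 2 ≤ ∫ t in J, f t := by
  rcases hJ with rfl | rfl
  · rw [setIntegral_univ]
    linarith [integral_nonneg (μ := volume) (f := f) hf0]
  · have h1 : ∀ t, f |t| = f t := fun t => by
      rcases abs_choice t with h | h <;> simp [h, hf]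
    rw [integral_Ici_eq_integral_Ioi]
    have h2 := integral_comp_abs (f := f)
    simp only [h1] at h2
    linarith

/-! ### Uniform boundedness and a non-regular Fourier transform. -/

/-- The uniform boundedness principle for integration against a sequence of Schwartz functions
on `Lᵖ(J)`, tested on their complex conjugates. -/
theorem exists_setIntegral_norm_sq_le {p : ℝ≥0∞} (hp : 1 ≤ p) (hp' : p ≠ ⊤) (J : Set ℝ)
    (S : ℕ → 𝓢(ℝ, ℂ)) (h : ∀ f : ℝ → ℂ, MemLp f p (volume.restrict J) →
      ∃ C, ∀ n, ‖∫ t in J, S n t * f t‖ ≤ C) :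
    ∃ C, ∀ n, ∫ t in J, ‖S n t‖ ^ 2 ≤
      C * (∫ t in J, ‖S n t‖ ^ p.toReal) ^ p.toReal⁻¹ := by
  set μ := volume.restrict J
  have : Fact (1 ≤ p) := ⟨hp⟩
  have hpq : ENNReal.HolderConjugate p p.conjExponent := .conjExponent hp
  have hpq' : ENNReal.HolderConjugate p.conjExponent p := hpq.symm
  have : Fact (1 ≤ p.conjExponent) := ⟨ENNReal.HolderConjugate.one_le _ p⟩
  have hS : ∀ (q : ℝ≥0∞) n, MemLp (S n) q μ := fun q n => ((S n).memLp q volume).restrict J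
  let T : ℕ → Lp ℂ p μ →L[ℂ] ℂ := fun n =>
    (ContinuousLinearMap.mul ℂ ℂ).lpPairing μ p.conjExponent p ((hS p.conjExponent n).toLp _)
  have hT : ∀ n (f : Lp ℂ p μ), T n f = ∫ t, S n t * f t ∂μ := fun n f => by
    rw [lpPairing_eq_integral]
    refine integral_congr_ae ?_
    filter_upwards [(hS p.conjExponent n).coeFn_toLp] with t ht
    rw [ht, mul_apply']
  obtain ⟨C, hC⟩ := banach_steinhaus (g := T) fun f => by
    obtain ⟨C, hC⟩ := h f (Lp.memLp f)
    exact ⟨C, fun n => (hT n f) ▸ hC n⟩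
  refine ⟨C, fun n => ?_⟩
  have hconj : MemLp (fun t => starRingEnd ℂ (S n t)) p μ := (hS p n).star
  have h1 : T n (hconj.toLp _) = ((∫ t, ‖S n t‖ ^ 2 ∂μ : ℝ) : ℂ) := by
    rw [hT, ← integral_complex_ofReal]
    refine integral_congr_ae ?_
    filter_upwards [hconj.coeFn_toLp] with t ht
    rw [ht, Complex.mul_conj']
    push_cast
    rfl
  have h2 : ‖hconj.toLp _‖ = (∫ t, ‖S n t‖ ^ p.toReal ∂μ) ^ p.toReal⁻¹ := by
    rw [Lp.norm_toLp, hconj.eLpNorm_eq_integral_rpow_norm (by positivity) hp',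
      ENNReal.toReal_ofReal (by positivity)]
    simp only [RCLike.norm_conj]
  have h3 := ((T n).le_of_opNorm_le (hC n) (hconj.toLp _))
  rwa [h1, h2, Complex.norm_real,
    Real.norm_of_nonneg (integral_nonneg fun _ => by positivity)] at h3

/-- There is a function in `Lᵖ(J, X)`, `2 < p < ∞`, whose Fourier transform is not regular. -/
theorem exists_memLp_not_fourierIsRegular [CompleteSpace X] [Nontrivial X] {J : Set ℝ}
    (hJ : J = Set.univ ∨ J = Set.Ici 0) {p : ℝ≥0∞} (hp : 2 < p) (hp' : p ≠ ⊤) :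
    ∃ F : ℝ → X, MemLp F p (volume.restrict J) ∧ ¬ FourierIsRegular (J.indicator F) := by
  by_contra! hcon
  obtain ⟨x₀, hx₀⟩ := exists_ne (0 : X)
  have hx₀' : 0 < ‖x₀‖ := norm_pos_iff.2 hx₀
  have hJm := (isClosed_of_eq_univ_or_Ici hJ).measurableSet
  obtain ⟨b, hb, hbc, hb1, heven, hb0, hble⟩ := exists_even_bump
  let Θ : ℕ → 𝓢(ℝ, ℂ) := fun n => (hasCompactSupport_chirp hbc n).toSchwartzMap (contDiff_chirp hb n)
  have hΘ : ∀ n ξ, 𝓕 (Θ n) ξ = 𝓕 (chirp b n) ξ := fun n ξ => by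
    rw [SchwartzMap.fourier_coe]
    rfl
  have hpi : (0 : ℝ) < 2 * Real.pi := by positivity
  have hdilc : HasCompactSupport fun t => b (t / (2 * Real.pi)) := by
    simp only [div_eq_mul_inv]
    exact hbc.comp_homeomorph (Homeomorph.mulRight₀ (2 * Real.pi)⁻¹ (by positivity))
  have hnorm : ∀ n t, ‖((2 * Real.pi : ℝ) : ℂ)⁻¹ * chirp b n (t / (2 * Real.pi))‖ ≤
      b (t / (2 * Real.pi)) := fun n t => by
    rw [norm_mul, norm_chirp, abs_of_nonneg (hb0 _), norm_inv, Complex.norm_real,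
      Real.norm_of_nonneg hpi.le]
    exact mul_le_of_le_one_left (hb0 _) (inv_le_one_of_one_le₀ (by linarith [Real.pi_gt_three]))
  let φ : ℕ → TestFn := fun n => mkTestFn
    (fun t => ((2 * Real.pi : ℝ) : ℂ)⁻¹ * chirp b n (t / (2 * Real.pi)))
    (contDiff_const.mul ((contDiff_chirp hb n).comp (contDiff_id.div_const _)))
    (hdilc.mono' fun t ht => subset_tsupport _ fun h0 => ht (norm_le_zero_iff.1 (h0 ▸ hnorm n t)))
  have hhat : ∀ n s, hat (φ n) s = 𝓕 (Θ n) s := fun n s => by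
    rw [hΘ]
    exact hat_comp_div _ s
  obtain ⟨C, hC⟩ := exists_setIntegral_norm_sq_le (one_le_two.trans hp.le) hp' J
    (fun n => 𝓕 (Θ n)) fun f hf => by
      obtain ⟨H, hH, hreg⟩ := hcon (fun t => f t • x₀) 
        ((toSpanSingleton ℂ x₀).comp_memLp' hf)
      have hHi : IntegrableOn H (tsupport fun t => b (t / (2 * Real.pi))) :=
        hH.integrableOn_isCompact hdilc.isCompact
      -- All `φ n` are bounded by `1` and vanish off one compact set, so this bound does not depend
      -- on `n`.
      refine ⟨(∫ t in tsupport fun t => b (t / (2 * Real.pi)), ‖H t‖) / ‖x₀‖, fun n => ?_⟩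
      rw [le_div_iff₀ hx₀', ← norm_smul, ← integral_smul_const]
      have h1 : ∫ t in J, (𝓕 (Θ n) t * f t) • x₀ = ∫ t, φ n t • H t := by
        rw [← hreg, ← integral_indicator hJm]
        refine integral_congr_ae (Eventually.of_forall fun t => ?_)
        by_cases ht : t ∈ J
        · simp [ht, hhat, mul_smul]
        · simp [ht]
      rw [h1, ← integral_indicator (isClosed_tsupport _).measurableSet]
      refine norm_integral_le_of_norm_le
        ((integrable_indicator_iff (isClosed_tsupport _).measurableSet).2 hHi.norm)
        (Eventually.of_forall fun t => ?_)
      rw [norm_smul]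
      by_cases ht : t ∈ tsupport fun t => b (t / (2 * Real.pi))
      · rw [Set.indicator_of_mem ht]
        exact mul_le_of_le_one_left (norm_nonneg _) ((hnorm n t).trans (hble _))
      · have h2 : ‖φ n t‖ ≤ 0 := (hnorm n t).trans (image_eq_zero_of_notMem_tsupport ht).le
        rw [Set.indicator_of_notMem ht, norm_le_zero_iff.1 h2, norm_zero, zero_mul]
  set P := p.toReal
  have hP : 2 < P := by
    have := (ENNReal.toReal_lt_toReal (by simp) hp').2 hp
    simpa using this
  set E := ∫ t, (b t) ^ 2
  have hE : 0 < E := by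
    refine (hb.continuous.pow 2).integral_pos_of_hasCompactSupport_nonneg_nonzero (x := 0) ?_
      (fun t => sq_nonneg _) (by simp [hb1])
    exact hbc.comp_left (g := fun y : ℝ => y ^ 2) (by simp)
  have hplan : ∀ n, ∫ ξ, ‖𝓕 (Θ n) ξ‖ ^ 2 = E := fun n => by
    rw [SchwartzMap.integral_norm_sq_fourier]
    refine integral_congr_ae (Eventually.of_forall fun t => ?_)
    change ‖chirp b n t‖ ^ 2 = b t ^ 2
    rw [norm_chirp, sq_abs]
  set a : ℕ → ℝ := fun n =>
    √(∫ u, ‖(conjReflect (chirp b n) ⋆[lsmul ℂ ℂ] chirp b n) u‖)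
  have ha0 : ∀ n, 0 ≤ a n := fun n => Real.sqrt_nonneg _
  have ha : Tendsto a atTop (𝓝 0) := by
    have := (tendsto_integral_norm_autocorrelation_chirp hb hbc heven).sqrt
    rwa [Real.sqrt_zero] at this
  have hsup : ∀ n ξ, ‖𝓕 (Θ n) ξ‖ ≤ a n := fun n ξ => by
    rw [hΘ]
    exact Real.le_sqrt_of_sq_le (norm_sq_fourier_le ((contDiff_chirp hb
      n).continuous.integrable_of_hasCompactSupport (hasCompactSupport_chirp hbc n)) ξ)
  have hsqi : ∀ n, Integrable fun ξ => ‖𝓕 (Θ n) ξ‖ ^ 2 := fun n =>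
    ((𝓕 (Θ n)).memLp 2 volume).integrable_norm_pow (by simp)
  -- Interpolation between the sup norm and `L²`; `P > 2` gives `a n` a positive exponent.
  have hpow : ∀ n, ∫ t in J, ‖𝓕 (Θ n) t‖ ^ P ≤ a n ^ (P - 2) * E := fun n => by
    rw [← hplan n, ← integral_const_mul]
    refine (integral_mono_of_nonneg (Eventually.of_forall fun t => by positivity)
      ((hsqi n).const_mul _).restrict (Eventually.of_forall fun t => ?_)).trans
      (setIntegral_le_integral ((hsqi n).const_mul _) (Eventually.of_forall fun t =>
        mul_nonneg (Real.rpow_nonneg (ha0 n) _) (sq_nonneg _)))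
    calc ‖𝓕 (Θ n) t‖ ^ P = ‖𝓕 (Θ n) t‖ ^ (P - 2) * ‖𝓕 (Θ n) t‖ ^ 2 := by
          rw [← Real.rpow_natCast, ← Real.rpow_add_of_nonneg (norm_nonneg _) (by linarith)
            (by positivity)]
          norm_num
      _ ≤ a n ^ (P - 2) * ‖𝓕 (Θ n) t‖ ^ 2 := by
          gcongr
          exact hsup n t
  have hlower : ∀ n, E / 2 ≤ |C| * (a n ^ (P - 2) * E) ^ P⁻¹ := fun n => by
    rw [← hplan n]
    refine (half_integral_le_setIntegral hJ (fun t => sq_nonneg _) fun t => ?_).trans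
      ((hC n).trans ?_)
    · rw [hΘ, hΘ, fourier_neg_of_even (chirp_neg heven n)]
    · have h4 := Real.rpow_le_rpow (integral_nonneg fun t => by positivity) (hpow n)
        (show 0 ≤ P⁻¹ by positivity)
      rw [hplan n]
      exact mul_le_mul (le_abs_self C) h4 (by positivity) (abs_nonneg C)
  have hlim : Tendsto (fun n => |C| * (a n ^ (P - 2) * E) ^ P⁻¹) atTop (𝓝 0) := by
    have h5 := ((ha.rpow_const (Or.inr (by linarith : 0 ≤ P - 2))).mul_const E).rpow_const
      (p := P⁻¹) (Or.inr (by positivity))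
    rw [Real.zero_rpow (by linarith), zero_mul, Real.zero_rpow (by positivity)] at h5
    simpa using h5.const_mul |C|
  linarith [ge_of_tendsto' hlim hlower]

end ReducedSpectrum

theorem corollary3p10 {X : Type*} [NormedAddCommGroup X] [NormedSpace ℂ X] [CompleteSpace X]
    (J : Set ℝ) (hJ : J = Set.univ ∨ J = Set.Ici 0) :
    (∀ F : ℝ → X, LocallyIntegrableOn F J volume →
      ReducedSpectrum.reducedSpectrum J (ReducedSpectrum.C0 J X) ReducedSpectrum.testFns F = ∅ →
      ∀ ψ : ReducedSpectrum.TestFn,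
        UniformContinuousOn (ReducedSpectrum.extConv J F ψ) J →
        ∃ g : C₀(ℝ, X), (g : ℝ → X) = ReducedSpectrum.extConv J F ψ) ∧
    (∀ (p : ℝ≥0∞) (F : ℝ → X), 1 ≤ p → p ≠ ∞ → MemLp F p (volume.restrict J) →
      LocallyIntegrableOn F J volume ∧
      ReducedSpectrum.reducedSpectrum J (ReducedSpectrum.C0 J X) ReducedSpectrum.testFns F = ∅ ∧
      ∀ ψ : ReducedSpectrum.TestFn, UniformContinuousOn (ReducedSpectrum.extConv J F ψ) J) ∧
    (Nontrivial X → ∀ p : ℝ≥0∞, 2 < p → p ≠ ∞ →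
      ∃ F : ℝ → X, MemLp F p (volume.restrict J) ∧
        ¬ ReducedSpectrum.FourierIsRegular (J.indicator F)) := by
  refine ⟨fun F hF hsp ψ hψ => ReducedSpectrum.exists_C0_eq_extConv hJ hF hsp ψ hψ,
    fun p F hp hp' hF => ReducedSpectrum.memLp_reducedSpectrum_eq_empty
      (ReducedSpectrum.isClosed_of_eq_univ_or_Ici hJ) hp hp' hF,
    fun _ p hp hp' => ReducedSpectrum.exists_memLp_not_fourierIsRegular hJ hp hp'⟩
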